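/- All graphs are finite and simple. Let $P_2$ be the path with two edges (three vertices). For a graph $G$, let $\mathrm{KG}(G,P_2)$ be the graph whose vertices are the edge sets of the subgraphs of $G$ isomorphic to $P_2$, two vertices being adjacent if and only if the corresponding edge sets are disjoint. Write $\chi$ for the chromatic number, with the convention that a graph without vertices has chromatic number $0$. Corollary. Let $G$ be a graph with $n$ vertices. If for any two distinct nonadjacent vertices $x$ and $y$ of $G$ we have $\deg_G(x)+\deg_G(y)\ge \frac{4n}{3}-1$, then $$\chi(\mathrm{KG}(G,P_2)) = |E(G)|-\left\lfloor \tfrac{2}{3}n\right\rfloor .$$ -/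

import Mathlib

/-- The general Kneser graph `KG(ℋ)` of a hypergraph `ℋ`: its vertices are the hyperedges of `ℋ`,
and two distinct hyperedges are adjacent exactly when they are disjoint.  (When all hyperedges are
nonempty, disjoint hyperedges are automatically distinct.) -/
def Hypergraph.kneserGraph {α : Type*} (ℋ : Hypergraph α) : SimpleGraph ℋ.edgeSet where
  Adj A B := A ≠ B ∧ Disjoint (A : Set α) (B : Set α)
  symm := ⟨fun _ _ h => ⟨h.1.symm, h.2.symm⟩⟩
  loopless := ⟨fun _ h => h.1 rfl⟩

namespace SimpleGraph

/-- The hypergraph `(G choose F)`: its vertices are the edges of `G`, and its hyperedges are the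
edge sets of the subgraphs of `G` isomorphic to `F`. -/
def copyHypergraph {V W : Type*} (G : SimpleGraph V) (F : SimpleGraph W) :
    Hypergraph (Sym2 V) where
  vertexSet := G.edgeSet
  edgeSet := {S | ∃ H : G.Subgraph, Nonempty (F ≃g H.coe) ∧ H.edgeSet = S}
  subset_vertexSet_of_mem_edgeSet' := by
    rintro _ ⟨H, -, rfl⟩
    exact H.edgeSet_subset

/-- The graph `KG(G, F)`, the Kneser graph of the hypergraph of copies of `F` in `G`. -/
abbrev copyKneserGraph {V W : Type*} (G : SimpleGraph V) (F : SimpleGraph W) :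
    SimpleGraph (G.copyHypergraph F).edgeSet :=
  (G.copyHypergraph F).kneserGraph

/-- The path `P_ℓ` of length `ℓ`: it has `ℓ` edges and `ℓ + 1` vertices. -/
abbrev pathOfLength (l : ℕ) : SimpleGraph (Fin (l + 1)) := SimpleGraph.pathGraph (l + 1)

end SimpleGraph

/-! Lower bound, valid for every graph: a colour class is an intersecting family of pairs of edges,
so its members share an edge or it has at most three members
(`Set.exists_card_le_three_of_intersecting_pairs`). Delete one common edge for each class of the
first kind. Every surviving two-edge path has a colour of the second kind, hence there are at most
three per such colour. A graph on n vertices with p two-edge paths has at most (2n + p)/3 edges, and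
the bound follows.

Upper bound: partition the vertices into at most ⌈n/3⌉ cliques of order at most three and choose a
spanning star in each. The edges outside the stars serve as colours. A path leaving its part takes a
crossing edge; a path inside a triangle takes the edge opposite the root, and any two paths in one
triangle share an edge.

The partition comes from an Ore-type Corrádi–Hajnal theorem (`hasTriangleTiling_univ_of_ore`), after
adding up to two universal vertices. There a missing edge xy is added and the larger graph is tiled
by induction, so only one triangle xyz may be damaged. Degree counting then yields a retiling of two
or three parts. -/

section

open Finset

/-! ### Triangle tilings under an Ore-type condition. -/

namespace SimpleGraph

variable {V : Type*} [DecidableEq V] {G : SimpleGraph V}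

/-- The finite set `s` can be partitioned into triangles of `G`. -/
def HasTriangleTiling (G : SimpleGraph V) (s : Finset V) : Prop :=
  ∃ 𝒯 : Finset (Finset V), (𝒯 : Set (Finset V)).PairwiseDisjoint id ∧ 𝒯.biUnion id = s ∧
    ∀ t ∈ 𝒯, G.IsNClique 3 t

theorem IsNClique.hasTriangleTiling {t : Finset V} (h : G.IsNClique 3 t) :
    G.HasTriangleTiling t :=
  ⟨{t}, by simp, by simp, by simpa using h⟩

theorem HasTriangleTiling.union {s t : Finset V} (hs : G.HasTriangleTiling s)
    (ht : G.HasTriangleTiling t) (hst : Disjoint s t) : G.HasTriangleTiling (s ∪ t) := by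
  obtain ⟨S, hS, rfl, hS'⟩ := hs
  obtain ⟨T, hT, rfl, hT'⟩ := ht
  refine ⟨S ∪ T, ?_, by rw [union_biUnion], ?_⟩
  · rw [coe_union, Set.pairwiseDisjoint_union]
    refine ⟨hS, hT, fun i hi j hj _ => ?_⟩
    exact hst.mono (subset_biUnion_of_mem id hi) (subset_biUnion_of_mem id hj)
  · intro t ht
    rcases mem_union.1 ht with h | h
    exacts [hS' t h, hT' t h]

theorem HasTriangleTiling.congr {s t : Finset V} (hs : G.HasTriangleTiling s) (h : s = t) :
    G.HasTriangleTiling t :=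
  h ▸ hs

theorem hasTriangleTiling_of_complete (h : ∀ x y, x ≠ y → G.Adj x y) (k : ℕ) (s : Finset V)
    (hs : #s = 3 * k) : G.HasTriangleTiling s := by
  induction k generalizing s with
  | zero => exact ⟨∅, by simp, by simp [card_eq_zero.1 hs], by simp⟩
  | succ k ih =>
    obtain ⟨t, hts, ht⟩ := exists_subset_card_eq (show 3 ≤ #s by omega)
    have := (ih (s \ t) (by rw [card_sdiff_of_subset hts]; omega)).union
      (IsNClique.hasTriangleTiling ⟨fun x _ y _ hxy => h x y hxy, ht⟩) sdiff_disjoint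
    rwa [sdiff_union_of_subset hts] at this

/-- A partition can be completed to a triangle tiling if some of its parts are retiled and all
the other parts are triangles. -/
theorem HasTriangleTiling.of_subfamily {𝒯 𝒰 : Finset (Finset V)} {s : Finset V}
    (hd : (𝒯 : Set (Finset V)).PairwiseDisjoint id) (hc : 𝒯.biUnion id = s) (hU : 𝒰 ⊆ 𝒯)
    (hcl : ∀ t ∈ 𝒯, t ∉ 𝒰 → G.IsNClique 3 t) (h : G.HasTriangleTiling (𝒰.biUnion id)) :
    G.HasTriangleTiling s := by
  have h1 : G.HasTriangleTiling ((𝒯 \ 𝒰).biUnion id) :=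
    ⟨𝒯 \ 𝒰, hd.subset (by simp), rfl, fun t ht => hcl t (mem_sdiff.1 ht).1 (mem_sdiff.1 ht).2⟩
  have h2 := h.union h1 <| by
    simp only [disjoint_biUnion_left, disjoint_biUnion_right]
    intro i hi j hj
    rw [mem_sdiff] at hi
    exact hd (hU ‹_›) hi.1 (by rintro rfl; exact hi.2 ‹_›)
  rwa [← union_biUnion, union_sdiff_of_subset hU, hc] at h2

theorem card_filter_triple {p : V → Prop} [DecidablePred p] {a b c : V} (hab : a ≠ b)
    (hac : a ≠ c) (hbc : b ≠ c) :
    #{w ∈ ({a, b, c} : Finset V) | p w} =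
      (if p a then 1 else 0) + (if p b then 1 else 0) + (if p c then 1 else 0) := by
  rw [card_filter, sum_insert (by simp [hab, hac]), sum_insert (by simp [hbc]), sum_singleton,
    add_assoc]

/-- At most one of the six incidences fails; `a` names the vertex where it may fail. -/
theorem exists_triple_of_five_le {p q : V → Prop} [DecidablePred p] [DecidablePred q]
    {t : Finset V} (ht : #t = 3) (h : 5 ≤ #{w ∈ t | p w} + #{w ∈ t | q w}) :
    ∃ a b c, a ≠ b ∧ a ≠ c ∧ b ≠ c ∧ t = {a, b, c} ∧
      (p a ∧ p b ∧ p c ∧ q b ∧ q c ∨ q a ∧ q b ∧ q c ∧ p b ∧ p c) := by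
  obtain ⟨a, b, c, hab, hac, hbc, rfl⟩ := card_eq_three.1 ht
  rw [card_filter_triple hab hac hbc, card_filter_triple hab hac hbc] at h
  have e1 : ({a, b, c} : Finset V) = {b, a, c} := insert_comm _ _ _
  have e2 : ({a, b, c} : Finset V) = {c, a, b} := by rw [pair_comm b c, insert_comm]
  by_cases pa : p a ∧ q a
  · by_cases pb : p b ∧ q b
    · refine ⟨c, a, b, hac.symm, hbc.symm, hab, e2, ?_⟩
      split_ifs at h <;> first | omega | tauto
    · refine ⟨b, a, c, hab.symm, hbc, hac, e1, ?_⟩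
      split_ifs at h <;> first | omega | tauto
  · refine ⟨a, b, c, hab, hac, hbc, rfl, ?_⟩
    split_ifs at h <;> first | omega | tauto

theorem HasTriangleTiling.two {a b c d e f : V} {s : Finset V} (h1 : G.IsNClique 3 {a, b, c})
    (h2 : G.IsNClique 3 {d, e, f}) (hs : s = {a, b, c} ∪ {d, e, f}) (hc : 6 ≤ #s) :
    G.HasTriangleTiling s := by
  subst hs
  refine h1.hasTriangleTiling.union h2.hasTriangleTiling ?_
  have := card_union_add_card_inter ({a, b, c} : Finset V) {d, e, f}
  rw [h1.card_eq, h2.card_eq] at this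
  rw [disjoint_iff_inter_eq_empty, ← card_eq_zero]
  omega

theorem HasTriangleTiling.three {A B C s : Finset V} (hA : G.IsNClique 3 A)
    (hB : G.IsNClique 3 B) (hC : G.IsNClique 3 C) (hs : s = A ∪ B ∪ C) (hc : 9 ≤ #s) :
    G.HasTriangleTiling s := by
  subst hs
  have h1 := card_union_add_card_inter A B
  have h2 := card_union_add_card_inter (A ∪ B) C
  rw [hA.card_eq, hB.card_eq] at h1
  rw [hC.card_eq] at h2
  refine (hA.hasTriangleTiling.union hB.hasTriangleTiling ?_).union hC.hasTriangleTiling ?_ <;>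
  · rw [disjoint_iff_inter_eq_empty, ← card_eq_zero]
    omega

/-- A path `u - w - v` and a triangle receiving at least five edges from `u` and `v` span two
disjoint triangles as soon as `w` has a neighbour in the triangle. -/
theorem hasTriangleTiling_of_path [DecidableRel G.Adj] {u v w p : V} {t : Finset V}
    (huv : u ≠ v) (hwu : G.Adj w u) (hwv : G.Adj w v) (ht : G.IsNClique 3 t)
    (hd : Disjoint {u, v, w} t)
    (h : 5 ≤ #{x ∈ t | G.Adj u x} + #{x ∈ t | G.Adj v x}) (hp : p ∈ t) (hwp : G.Adj w p) :
    G.HasTriangleTiling ({u, v, w} ∪ t) := by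
  have hcard : 6 ≤ #({u, v, w} ∪ t) := by
    rw [card_union_of_disjoint hd, ht.card_eq, card_eq_three.2 ⟨u, v, w, huv, hwu.ne', hwv.ne', rfl⟩]
  have key : ∀ u v a b c : V, {u, v, w} ∪ t = {u, v, w} ∪ {a, b, c} → t = {a, b, c} →
      6 ≤ #({u, v, w} ∪ t) → G.Adj w u → G.Adj w v →
      G.Adj u a → G.Adj u b → G.Adj u c → G.Adj v b → G.Adj v c →
      G.HasTriangleTiling ({u, v, w} ∪ t) := by
    intro u v a b c _ htt hcard hwu hwv ua ub uc vb vc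
    have ht' := ht
    rw [htt, is3Clique_triple_iff] at ht'
    obtain ⟨ab, ac, bc⟩ := ht'
    rw [htt] at hp hcard ⊢
    simp only [mem_insert, mem_singleton] at hp
    -- The edge `w p` is completed by `u` if `p = a` and by `v` otherwise; the other of the two
    -- closes up the rest of `t`.
    rcases hp with rfl | rfl | rfl
    · exact .two (is3Clique_triple_iff.2 ⟨hwu, hwp, ua⟩) (is3Clique_triple_iff.2 ⟨vb, vc, bc⟩)
        (by simp only [insert_eq]; ac_rfl) hcard
    · exact .two (is3Clique_triple_iff.2 ⟨hwv, hwp, vb⟩) (is3Clique_triple_iff.2 ⟨ua, uc, ac⟩)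
        (by simp only [insert_eq]; ac_rfl) hcard
    · exact .two (is3Clique_triple_iff.2 ⟨hwv, hwp, vc⟩) (is3Clique_triple_iff.2 ⟨ua, ub, ab⟩)
        (by simp only [insert_eq]; ac_rfl) hcard
  obtain ⟨a, b, c, -, -, -, htt, ⟨h1, h2, h3, h4, h5⟩ | ⟨h1, h2, h3, h4, h5⟩⟩ :=
    exists_triple_of_five_le ht.card_eq h
  · exact key u v a b c (by rw [htt]) htt hcard hwu hwv h1 h2 h3 h4 h5
  · rw [insert_comm] at hcard ⊢
    exact key v u a b c (by rw [htt]) htt hcard hwv hwu h1 h2 h3 h4 h5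

/-- The exchange step: on a further triangle `t`, the path `y - z - x` and the triangle `abc` have
bounded weighted degree unless the nine vertices can be retiled. -/
theorem weight_le_twelve [DecidableRel G.Adj] {x y z a b c : V} {t : Finset V}
    (hxy : x ≠ y) (hzx : G.Adj z x) (hzy : G.Adj z y) (hza : z ≠ a)
    (hT : G.IsNClique 3 {a, b, c})
    (xa : G.Adj x a) (xb : G.Adj x b) (xc : G.Adj x c) (yb : G.Adj y b) (yc : G.Adj y c)
    (ht : G.IsNClique 3 t) (hd1 : Disjoint {x, y, z} ({a, b, c} : Finset V))
    (hd2 : Disjoint {x, y, z} t) (hd3 : Disjoint {a, b, c} t)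
    (hno : ¬ G.HasTriangleTiling ({x, y, z} ∪ {a, b, c} ∪ t)) :
    #{w ∈ t | G.Adj x w} + #{w ∈ t | G.Adj y w} + 2 * #{w ∈ t | G.Adj z w} +
      2 * #{w ∈ t | G.Adj a w} ≤ 12 := by
  have hle : ∀ v, #{w ∈ t | G.Adj v w} ≤ 3 := fun v => (card_filter_le _ _).trans ht.card_eq.le
  have hx := hle x
  have hy := hle y
  have hz := hle z
  have ha := hle a
  obtain ⟨ab, ac, bc⟩ := is3Clique_triple_iff.1 hT
  have hcard : #({x, y, z} ∪ {a, b, c} ∪ t) = 9 := by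
    rw [card_union_of_disjoint (disjoint_union_left.2 ⟨hd2, hd3⟩), card_union_of_disjoint hd1,
      ht.card_eq, hT.card_eq, card_eq_three.2 ⟨x, y, z, hxy, hzx.ne', hzy.ne', rfl⟩]
  -- Here `z` has no neighbour in `t`, so the weight is at most 6 + 0 + 6.
  by_cases h1 : 5 ≤ #{w ∈ t | G.Adj x w} + #{w ∈ t | G.Adj y w}
  · have : #{w ∈ t | G.Adj z w} = 0 := by
      rw [card_eq_zero, filter_eq_empty_iff]
      intro p hp hzp
      refine hno ?_
      exact (hasTriangleTiling_of_path hxy hzx hzy ht hd2 h1 hp hzp).union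
        hT.hasTriangleTiling (disjoint_union_left.2 ⟨hd1, hd3.symm⟩) |>.congr
        (by simp only [insert_eq]; ac_rfl)
    omega
  by_cases h2 : 5 ≤ #{w ∈ t | G.Adj z w} + #{w ∈ t | G.Adj a w}
  swap
  -- Both sums are at most 4, so the weight is at most 4 + 2 * 4.
  · omega
  -- The path is now `z - x - a`, with `y b c` left over as a triangle.
  have hx0 : #{w ∈ t | G.Adj x w} = 0 := by
    rw [card_eq_zero, filter_eq_empty_iff]
    intro p hp hxp
    refine hno ?_
    refine (hasTriangleTiling_of_path hza hzx.symm xa ht ?_ h2 hp hxp).union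
      (is3Clique_triple_iff.2 ⟨yb, yc, bc⟩).hasTriangleTiling ?_ |>.congr
        (by simp only [insert_eq]; ac_rfl)
    · simp only [disjoint_insert_left, disjoint_singleton_left] at hd2 hd3 ⊢
      exact ⟨hd2.2.2, hd3.1, hd2.1⟩
    · have hn1 := hzy.ne
      have hn2 := ab.ne
      have hn3 := ac.ne
      simp only [disjoint_insert_left, disjoint_singleton_left, disjoint_insert_right,
        disjoint_singleton_right, mem_insert, mem_singleton] at hd1 hd2 hd3 ⊢
      grind
  have key : ∀ d e f, t = {d, e, f} → G.Adj y d → G.Adj z d → G.Adj a e → G.Adj a f → False := by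
    intro d e f htt yd zd ae af
    subst htt
    obtain ⟨de, df, ef⟩ := is3Clique_triple_iff.1 ht
    exact hno <| .three (is3Clique_triple_iff.2 ⟨hzy, zd, yd⟩)
      (is3Clique_triple_iff.2 ⟨ae, af, ef⟩) (is3Clique_triple_iff.2 ⟨xb, xc, bc⟩)
      (by simp only [insert_eq]; ac_rfl) hcard.ge
  obtain ⟨d, e, f, de, df, ef, htt, h3⟩ := exists_triple_of_five_le ht.card_eq h2
  have k1 := key d e f htt
  have k2 := key e d f (by rw [htt, insert_comm])
  have k3 := key f d e (by rw [htt, pair_comm e f, insert_comm])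
  rw [htt, card_filter_triple de df ef] at hx0
  rw [htt, card_filter_triple de df ef, card_filter_triple de df ef, card_filter_triple de df ef,
    card_filter_triple de df ef, hx0]
  rcases h3 with ⟨h1, h2, h3, h4, h5⟩ | ⟨h1, h2, h3, h4, h5⟩
  · have : ¬ G.Adj y d := fun h => k1 h h1 h4 h5
    simp only [h1, h2, h3, h4, h5, this]
    by_cases had : G.Adj a d
    · have : ¬ G.Adj y e := fun h => k2 h h2 had h5
      have : ¬ G.Adj y f := fun h => k3 h h3 had h4
      simp [*]
    · simp only [had, if_true, if_false]; split_ifs <;> simp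
  · have y1 : ¬ G.Adj y e := fun h => k2 h h4 h1 h3
    have y2 : ¬ G.Adj y f := fun h => k3 h h5 h1 h2
    by_cases hzd : G.Adj z d
    · have : ¬ G.Adj y d := fun h => k1 h hzd h2 h3
      simp [*]
    · simp only [h1, h2, h3, h4, h5, y1, y2, hzd, if_true, if_false]; split_ifs <;> simp

theorem degree_eq_sum_of_partition [Fintype V] [DecidableRel G.Adj] {𝒯 : Finset (Finset V)}
    (hd : (𝒯 : Set (Finset V)).PairwiseDisjoint id) (hc : 𝒯.biUnion id = univ) (v : V) :
    G.degree v = ∑ t ∈ 𝒯, #{w ∈ t | G.Adj v w} := by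
  rw [← card_neighborFinset_eq_degree, neighborFinset_eq_filter, ← hc, filter_biUnion,
    card_biUnion fun s hs t ht hst => disjoint_filter_filter (hd hs ht hst)]
  rfl

/-- Weigh the degrees of `x, y, z, a` by 1, 1, 2, 2. The nonadjacent pairs `x, y` and `z, a` force
at least 3(4k - 1) = 12k - 3. The other k - 2 triangles contribute at most 12 each by
`weight_le_twelve`, and the six vertices `x, y, z, a, b, c` at most 20: in total only 12k - 4. -/
theorem hasTriangleTiling_of_exchange [Fintype V] [DecidableRel G.Adj] {k : ℕ}
    (hk : Fintype.card V = 3 * k)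
    (hdeg : ∀ x y, x ≠ y → ¬ G.Adj x y → 4 * k ≤ G.degree x + G.degree y + 1)
    {𝒯 : Finset (Finset V)} (hd : (𝒯 : Set (Finset V)).PairwiseDisjoint id)
    (hc : 𝒯.biUnion id = univ) (h3 : ∀ t ∈ 𝒯, #t = 3) {x y z a b c : V}
    (hcl : ∀ t ∈ 𝒯, t ≠ {x, y, z} → G.IsNClique 3 t)
    (hxyz : {x, y, z} ∈ 𝒯) (habc : {a, b, c} ∈ 𝒯) (hxy : x ≠ y) (nxy : ¬ G.Adj x y)
    (hzx : G.Adj z x) (hzy : G.Adj z y)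
    (hne : ({a, b, c} : Finset V) ≠ {x, y, z})
    (xa : G.Adj x a) (xb : G.Adj x b) (xc : G.Adj x c) (yb : G.Adj y b) (yc : G.Adj y c) :
    G.HasTriangleTiling univ := by
  by_contra hno
  have hT := hcl _ habc hne
  obtain ⟨ab, ac, bc⟩ := is3Clique_triple_iff.1 hT
  have hd1 : Disjoint {x, y, z} ({a, b, c} : Finset V) := hd hxyz habc hne.symm
  have hz : ∀ p ∈ ({a, b, c} : Finset V), ¬ G.Adj z p := by
    intro p hp hzp
    refine hno <| .of_subfamily (𝒰 := {{x, y, z}, {a, b, c}}) hd hc ?_ ?_ ?_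
    · simp [insert_subset_iff, hxyz, habc]
    · intro t ht ht'
      exact hcl t ht (by rintro rfl; simp at ht')
    · refine (hasTriangleTiling_of_path hxy hzx hzy hT hd1 ?_ hp hzp).congr (by simp)
      rw [card_filter_triple ab.ne ac.ne bc.ne, card_filter_triple ab.ne ac.ne bc.ne]
      simp only [xa, xb, xc, yb, yc, if_true]; omega
  have za := hz a (by simp)
  have hza : z ≠ a := by
    rintro rfl
    exact hz b (by simp) ab
  have hcard : #𝒯 = k := by
    have : #(𝒯.biUnion id) = ∑ t ∈ 𝒯, #t := card_biUnion hd
    rw [hc, card_univ, hk, sum_congr rfl h3, sum_const, smul_eq_mul] at this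
    omega
  have hrest : ∀ t ∈ (𝒯.erase {x, y, z}).erase {a, b, c},
      #{w ∈ t | G.Adj x w} + #{w ∈ t | G.Adj y w} + 2 * #{w ∈ t | G.Adj z w} +
        2 * #{w ∈ t | G.Adj a w} ≤ 12 := by
    intro t ht
    simp only [mem_erase] at ht
    refine weight_le_twelve hxy hzx hzy hza hT xa xb xc yb yc (hcl t ht.2.2 ht.2.1) hd1
      (hd hxyz ht.2.2 ht.2.1.symm) (hd habc ht.2.2 ht.1.symm) fun h => hno ?_
    refine .of_subfamily (𝒰 := {{x, y, z}, {a, b, c}, t}) hd hc ?_ ?_ (h.congr ?_)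
    · simp [insert_subset_iff, hxyz, habc, ht]
    · intro s hs hs'
      exact hcl s hs (by rintro rfl; simp at hs')
    · simp only [biUnion_insert, singleton_biUnion, id_eq, union_assoc]
  have hsum := sum_le_card_nsmul _ _ _ hrest
  have hmem : ({a, b, c} : Finset V) ∈ 𝒯.erase {x, y, z} := mem_erase.2 ⟨hne, habc⟩
  have hk2 : #((𝒯.erase {x, y, z}).erase {a, b, c}) + 2 = k := by
    have h1 := card_erase_add_one hmem
    have h2 := card_erase_add_one hxyz
    omega
  have hxz := hzx.ne'
  have hyz := hzy.ne'
  have dx := degree_eq_sum_of_partition (G := G) hd hc x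
  have dy := degree_eq_sum_of_partition (G := G) hd hc y
  have dz := degree_eq_sum_of_partition (G := G) hd hc z
  have da := degree_eq_sum_of_partition (G := G) hd hc a
  rw [← add_sum_erase _ _ hxyz, ← add_sum_erase _ _ hmem, card_filter_triple hxy hxz hyz,
    card_filter_triple ab.ne ac.ne bc.ne] at dx dy dz da
  simp only [sum_add_distrib, ← mul_sum, smul_eq_mul] at hsum
  have e1 := hdeg x y hxy nxy
  have e2 := hdeg z a hza za
  have nyx : ¬ G.Adj y x := fun h => nxy h.symm
  have naz : ¬ G.Adj a z := fun h => za h.symm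
  have nzb := hz b (by simp)
  have nzc := hz c (by simp)
  simp only [SimpleGraph.irrefl, nxy, nyx, hzx, hzx.symm, hzy, hzy.symm, xa, xa.symm, xb, xc, yb,
    yc, za, naz, nzb, nzc, ab, ac, G.adj_comm a y, if_true, if_false] at dx dy dz da
  by_cases ya : G.Adj y a <;> simp only [ya, if_true, if_false] at dy da <;> omega

open scoped Classical in
/-- A graph on `3k` vertices in which any two distinct nonadjacent vertices have degree sum at
least `4k - 1` can be partitioned into triangles. -/
theorem hasTriangleTiling_univ_of_ore [Fintype V] {k : ℕ} (hk : Fintype.card V = 3 * k)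
    (G : SimpleGraph V)
    (hdeg : ∀ x y, x ≠ y → ¬ G.Adj x y → 4 * k ≤ G.degree x + G.degree y + 1) :
    G.HasTriangleTiling univ := by
  induction G using WellFoundedGT.induction with
  | ind G ih =>
  by_cases hcompl : ∀ x y, x ≠ y → G.Adj x y
  · exact hasTriangleTiling_of_complete hcompl k univ (by rw [card_univ, hk])
  push Not at hcompl
  obtain ⟨x, y, hxy, nxy⟩ := hcompl
  have hlt : G < G ⊔ edge x y := by
    refine lt_of_le_of_ne le_sup_left fun h => nxy ?_
    rw [h, sup_adj]
    exact .inr ((edge_adj ..).2 ⟨.inl ⟨rfl, rfl⟩, hxy⟩)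
  have hmono : ∀ H : SimpleGraph V, G ≤ H → ∀ u, G.degree u ≤ H.degree u :=
    fun H h u => degree_le_of_le h
  obtain ⟨𝒯, hd, hc, hcl⟩ := ih _ hlt fun u v huv nuv => by
    refine (hdeg u v huv fun h => nuv (.inl h)).trans (Nat.succ_le_succ (add_le_add ?_ ?_)) <;>
      exact hmono _ hlt.le _
  have hadj : ∀ u v, (G ⊔ edge x y).Adj u v → ¬ (u = x ∧ v = y) → ¬ (u = y ∧ v = x) →
      G.Adj u v := by
    intro u v h h1 h2
    rcases h with h | h
    · exact h
    · rw [edge_adj] at h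
      tauto
  have hcl' : ∀ t ∈ 𝒯, ¬ (x ∈ t ∧ y ∈ t) → G.IsNClique 3 t := by
    intro t ht hxyt
    refine ⟨fun u hu v hv huv => hadj u v ((hcl t ht).1 hu hv huv) ?_ ?_, (hcl t ht).2⟩
    · rintro ⟨rfl, rfl⟩; exact hxyt ⟨hu, hv⟩
    · rintro ⟨rfl, rfl⟩; exact hxyt ⟨hv, hu⟩
  by_cases hex : ∃ t₀ ∈ 𝒯, x ∈ t₀ ∧ y ∈ t₀
  swap
  · push Not at hex
    exact ⟨𝒯, hd, hc, fun t ht => hcl' t ht fun h => hex t ht h.1 h.2⟩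
  obtain ⟨t₀, ht₀, hx, hy⟩ := hex
  have hcl₀ := hcl t₀ ht₀
  obtain ⟨z, hz⟩ : ∃ z, t₀ \ {x, y} = {z} := by
    rw [← card_eq_one, card_sdiff_of_subset (by simp [insert_subset_iff, hx, hy]), hcl₀.card_eq,
      card_pair hxy]
  have hz' : z ∈ t₀ \ {x, y} := by simp [hz]
  obtain rfl : t₀ = {x, y, z} := by
    rw [← sdiff_union_of_subset (show {x, y} ⊆ t₀ by simp [insert_subset_iff, hx, hy]), hz]
    simp only [insert_eq]; ac_rfl
  simp only [mem_sdiff, mem_insert, mem_singleton, not_or, or_true, true_and] at hz'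
  obtain ⟨-, hxz, hyz⟩ := is3Clique_triple_iff.1 hcl₀
  have hzx : G.Adj z x := (hadj x z hxz (by tauto) (by tauto)).symm
  have hzy : G.Adj z y := (hadj y z hyz (by tauto) (by tauto)).symm
  have hclG : ∀ t ∈ 𝒯, t ≠ {x, y, z} → G.IsNClique 3 t := by
    intro t ht hne
    refine hcl' t ht fun h => ?_
    exact Finset.disjoint_left.1 (hd ht ht₀ hne) h.1 (mem_insert_self _ _)
  have h3 : ∀ t ∈ 𝒯, #t = 3 := fun t ht => (hcl t ht).card_eq
  have hcard : #𝒯 = k := by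
    have : #(𝒯.biUnion id) = ∑ t ∈ 𝒯, #t := card_biUnion hd
    rw [hc, card_univ, hk, sum_congr rfl h3, sum_const, smul_eq_mul] at this
    omega
  -- Only two of the at least 4k - 1 edge ends at `x` and `y` go to `z`, and 4k - 3 exceeds 4(k -
  -- 1).
  obtain ⟨T, hT, hT5⟩ : ∃ T ∈ 𝒯.erase {x, y, z},
      5 ≤ #{w ∈ T | G.Adj x w} + #{w ∈ T | G.Adj y w} := by
    by_contra! hno
    have hsum := sum_le_card_nsmul _ _ 4 fun t ht => Nat.le_of_lt_succ (hno t ht)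
    have dx := degree_eq_sum_of_partition (G := G) hd hc x
    have dy := degree_eq_sum_of_partition (G := G) hd hc y
    have nyx : ¬ G.Adj y x := fun h => nxy h.symm
    rw [← add_sum_erase _ _ ht₀, card_filter_triple hxy hzx.ne' hzy.ne'] at dx dy
    simp only [SimpleGraph.irrefl, nxy, nyx, hzx.symm, hzy.symm, if_true, if_false] at dx dy
    rw [sum_add_distrib, smul_eq_mul] at hsum
    have h1 := card_erase_add_one ht₀
    have := hdeg x y hxy nxy
    omega
  rw [mem_erase] at hT
  obtain ⟨a, b, c, -, -, -, rfl, ⟨h1, h2, h4, h5, h6⟩ | ⟨h1, h2, h4, h5, h6⟩⟩ :=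
    exists_triple_of_five_le (h3 T hT.2) hT5
  · exact hasTriangleTiling_of_exchange hk hdeg hd hc h3 hclG ht₀ hT.2 hxy nxy hzx hzy hT.1
      h1 h2 h4 h5 h6
  · rw [insert_comm x y] at ht₀ hclG hT
    exact hasTriangleTiling_of_exchange hk hdeg hd hc h3 hclG ht₀ hT.2 hxy.symm
      (fun h => nxy h.symm) hzy hzx hT.1 h1 h2 h4 h5 h6

end SimpleGraph

/-! ### Upper bound: a colouring from a partition into small cliques. -/

namespace SimpleGraph

variable {V : Type*} {G : SimpleGraph V}

/-- Under the Ore-type condition `deg x + deg y ≥ 4n/3 - 1`, the vertices of `G` can be partitioned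
into at most `⌈n/3⌉` cliques of order at most three. The partition is given by the map sending
each vertex to a chosen representative of its part. -/
theorem exists_root_of_ore [Fintype V] [DecidableEq V] [DecidableRel G.Adj]
    (hdeg : ∀ x y, x ≠ y → ¬ G.Adj x y →
      4 * Fintype.card V ≤ 3 * (G.degree x + G.degree y) + 3) :
    ∃ root : V → V, (∀ u v, root u = root v → u ≠ v → G.Adj u v) ∧
      (∀ r, #{v | root v = r} ≤ 3) ∧ (∀ v, root (root v) = root v) ∧
      3 * #(univ.image root) ≤ Fintype.card V + 2 := by
  classical
  obtain ⟨m, k, hmk, hm⟩ : ∃ m k, Fintype.card V + m = 3 * k ∧ m ≤ 2 :=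
    ⟨3 * ((Fintype.card V + 2) / 3) - Fintype.card V, (Fintype.card V + 2) / 3, by omega, by omega⟩
  obtain ⟨H, hH, hH'⟩ : ∃ H : SimpleGraph (V ⊕ Fin m),
      (∀ u v, H.Adj (.inl u) (.inl v) ↔ G.Adj u v) ∧ ∀ i p, .inr i ≠ p → H.Adj (.inr i) p := by
    -- This is the join of `G` with a complete graph on `m` vertices.
    refine ⟨(Gᶜ ⊕g (⊥ : SimpleGraph (Fin m)))ᶜ, fun u v => ?_, ?_⟩
    · have : G.Adj u v → u ≠ v := fun h => h.ne
      simp only [compl_adj, sum_adj, ne_eq, Sum.inl.injEq]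
      tauto
    · rintro i (p | p) h <;> simp_all
  have hHdeg : ∀ v, G.degree v + m ≤ H.degree (.inl v) := by
    intro v
    have : (G.neighborFinset v).disjSum (univ : Finset (Fin m)) ⊆ H.neighborFinset (.inl v) := by
      intro x hx
      rw [mem_disjSum] at hx
      rw [mem_neighborFinset]
      obtain ⟨a, ha, rfl⟩ | ⟨a, -, rfl⟩ := hx
      · rw [mem_neighborFinset] at ha
        rwa [hH]
      · exact (hH' a _ (by simp)).symm
    simpa using card_le_card this
  obtain ⟨𝒯, hd, hc, hcl⟩ := hasTriangleTiling_univ_of_ore (k := k) (by simpa using hmk) H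
    (by
      rintro (x | x) (y | y) hxy nxy
      · have hxy' : x ≠ y := fun h => hxy (h ▸ rfl)
        have := hdeg x y hxy' fun h => nxy ((hH x y).2 h)
        have h1 := hHdeg x
        have h2 := hHdeg y
        omega
      · exact absurd (hH' y _ hxy.symm).symm nxy
      all_goals exact absurd (hH' x _ hxy) nxy)
  have hcard : #𝒯 = k := by
    have : #(𝒯.biUnion id) = ∑ t ∈ 𝒯, #t := card_biUnion hd
    rw [hc, card_univ, sum_congr rfl fun t ht => (hcl t ht).card_eq, sum_const, smul_eq_mul,
      Fintype.card_sum, Fintype.card_fin] at this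
    omega
  have hpart : ∀ v : V, ∃ t ∈ 𝒯, Sum.inl v ∈ t := by
    intro v
    have := mem_univ (Sum.inl v : V ⊕ Fin m)
    rw [← hc] at this
    simpa using this
  choose part hpart hmem using hpart
  let root : V → V := fun v => Set.rangeSplitting part ⟨part v, v, rfl⟩
  have hroot : ∀ v, part (root v) = part v := fun v => Set.apply_rangeSplitting part _
  have hroot_iff : ∀ u v, root u = root v ↔ part u = part v := by
    intro u v
    constructor
    · intro h
      rw [← hroot u, h, hroot]
    · intro h
      simp only [root, h]
  refine ⟨root, ?_, ?_, ?_, ?_⟩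
  · intro u v huv hne
    rw [hroot_iff] at huv
    exact (hH u v).1 ((hcl _ (hpart u)).1 (hmem u) (huv ▸ hmem v) (by simpa using hne))
  · intro r
    rw [← (hcl _ (hpart r)).card_eq]
    refine card_le_card_of_injOn Sum.inl (fun v hv => ?_) Sum.inl_injective.injOn
    have : root v = r := by simpa using hv
    rw [mem_coe, ← this, hroot]
    exact hmem v
  · intro v
    rw [hroot_iff, hroot]
  · have : #(univ.image root) ≤ #𝒯 := by
      refine card_le_card_of_injOn part (fun v _ => hpart v) ?_
      intro u hu v hv huv
      simp only [coe_image, coe_univ, Set.image_univ, Set.mem_range] at hu hv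
      obtain ⟨u, rfl⟩ := hu
      obtain ⟨v, rfl⟩ := hv
      rwa [hroot, hroot, ← hroot_iff] at huv
    omega

theorem mem_edgeSet_copyHypergraph_path_two {S : Set (Sym2 V)} :
    S ∈ (G.copyHypergraph (pathOfLength 2)).edgeSet ↔
      ∃ v u w, u ≠ w ∧ G.Adj v u ∧ G.Adj v w ∧ S = {s(v, u), s(v, w)} := by
  have hpath : (pathOfLength 2).edgeSet = {s(1, 0), s(1, 2)} := by
    ext e
    induction e with
    | h a b => fin_cases a <;> fin_cases b <;> simp [pathGraph_adj]
  have himage : ∀ f : Copy (pathOfLength 2) G,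
      f.toSubgraph.edgeSet = {s(f 1, f 0), s(f 1, f 2)} := by
    intro f
    rw [Subgraph.edgeSet_map, Subgraph.edgeSet_top, hpath, Set.image_pair]
    rfl
  constructor
  · rintro ⟨H, hH, rfl⟩
    obtain ⟨f, rfl⟩ : H ∈ Set.range Copy.toSubgraph := by
      rw [Copy.range_toSubgraph]; exact hH
    refine ⟨f 1, f 0, f 2, f.injective.ne (by decide), ?_, ?_, himage f⟩ <;>
    · exact f.toHom.map_adj (by simp [pathGraph_adj])
  · rintro ⟨v, u, w, huw, hu, hw, rfl⟩
    let f : Copy (pathOfLength 2) G := ⟨⟨![u, v, w], by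
      intro a b hab
      fin_cases a <;> fin_cases b <;> simp [pathGraph_adj, hu, hu.symm, hw, hw.symm] at hab ⊢⟩, by
      intro a b hab
      fin_cases a <;> fin_cases b <;>
        first
        | rfl
        | exact absurd hab hu.ne
        | exact absurd hab hu.ne'
        | exact absurd hab hw.ne
        | exact absurd hab hw.ne'
        | exact absurd hab huw
        | exact absurd hab huw.symm⟩
    exact ⟨f.toSubgraph, ⟨f.isoToSubgraph⟩, himage f⟩

theorem colorable_copyKneserGraph_path_two [Fintype V] [DecidableEq V] [Fintype G.edgeSet]
    {root : V → V} (hadj : ∀ u v, root u = root v → u ≠ v → G.Adj u v)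
    (hthree : ∀ r, #{v | root v = r} ≤ 3) (hroot : ∀ v, root (root v) = root v) :
    Fintype.card V ≤ #G.edgeFinset + #(univ.image root) ∧
    (G.copyKneserGraph (pathOfLength 2)).Colorable
      (#G.edgeFinset + #(univ.image root) - Fintype.card V) := by
  -- The union of the stars centred at the roots.
  let D : Finset (Sym2 V) := ({v | root v ≠ v} : Finset V).image fun v => s(v, root v)
  have hD : ∀ {e}, e ∈ D ↔ ∃ v, root v ≠ v ∧ s(v, root v) = e := by simp [D]
  have hDE : D ⊆ G.edgeFinset := by
    intro e he
    obtain ⟨v, hv, rfl⟩ := hD.1 he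
    rw [mem_edgeFinset]
    exact hadj _ _ (hroot v).symm hv.symm
  have hDcard : #D + #(univ.image root) = Fintype.card V := by
    rw [card_image_of_injOn]
    · have : univ.image root = ({v | ¬ root v ≠ v} : Finset V) := by
        ext v
        simp only [mem_image, mem_univ, true_and, mem_filter, not_not]
        exact ⟨fun ⟨u, hu⟩ => hu ▸ hroot u, fun h => ⟨v, h⟩⟩
      rw [this, card_filter_add_card_filter_not, card_univ]
    · intro v hv w hw hvw
      simp only [coe_filter, mem_univ, true_and, Set.mem_ofPred_eq] at hv hw
      rcases Sym2.eq_iff.1 hvw with h | h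
      · exact h.1
      · exact absurd (by rw [h.1, hroot]) hv
  have hcard : #(G.edgeFinset \ D) = #G.edgeFinset + #(univ.image root) - Fintype.card V := by
    rw [card_sdiff_of_subset hDE]
    omega
  refine ⟨by have := card_le_card hDE; omega, ?_⟩
  rw [← hcard, ← Fintype.card_coe]
  have hex : ∀ P : (G.copyHypergraph (pathOfLength 2)).edgeSet,
      ∃ e : ↥(G.edgeFinset \ D), (e.1 ∈ P.1 ∧ ¬ ∃ r, ∀ v ∈ e.1, root v = r) ∨
        ∃ r, (∀ v ∈ e.1, root v = r) ∧ ∀ f ∈ P.1, ∀ v ∈ f, root v = r := by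
    rintro ⟨P, hP⟩
    obtain ⟨v, u, w, huw, hu, hw, rfl⟩ := mem_edgeSet_copyHypergraph_path_two.1 hP
    have hcross : ∀ u, G.Adj v u → root u ≠ root v →
        s(v, u) ∈ G.edgeFinset \ D ∧ ¬ ∃ r, ∀ x ∈ s(v, u), root x = r := by
      intro u hu hne
      have hno : ¬ ∃ r, ∀ x ∈ s(v, u), root x = r := by
        rintro ⟨r, hr⟩
        exact hne ((hr u (by simp)).trans (hr v (by simp)).symm)
      refine ⟨mem_sdiff.2 ⟨mem_edgeFinset.2 hu, fun h => hno ?_⟩, hno⟩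
      obtain ⟨x, -, hx⟩ := hD.1 h
      rw [← hx]
      exact ⟨root x, by simp [hroot]⟩
    by_cases h1 : root u = root v
    swap
    · exact ⟨⟨_, (hcross u hu h1).1⟩, .inl ⟨by simp, (hcross u hu h1).2⟩⟩
    by_cases h2 : root w = root v
    swap
    · exact ⟨⟨_, (hcross w hw h2).1⟩, .inl ⟨by simp, (hcross w hw h2).2⟩⟩
    have hin : ∀ p q, p ≠ q → root p = root v → root q = root v → root v ≠ p → root v ≠ q →
        s(p, q) ∈ G.edgeFinset \ D := by
      intro p q hpq hp hq hp' hq'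
      refine mem_sdiff.2 ⟨mem_edgeFinset.2 (hadj p q (hp.trans hq.symm) hpq), fun h => ?_⟩
      obtain ⟨x, -, hx⟩ := hD.1 h
      rcases Sym2.eq_iff.1 hx with ⟨rfl, hxr⟩ | ⟨rfl, hxr⟩
      · exact hq' (hp.symm.trans hxr)
      · exact hp' (hq.symm.trans hxr)
    -- Otherwise the part would contain four vertices.
    have hr : root v = v ∨ root v = u ∨ root v = w := by
      by_contra! hno
      have : #({root v, v, u, w} : Finset V) ≤ #{x | root x = root v} := by
        refine card_le_card fun x hx => ?_
        simp only [mem_insert, mem_singleton] at hx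
        rcases hx with rfl | rfl | rfl | rfl <;> simp [hroot, h1, h2]
      rw [card_insert_of_notMem (by simp [hno]), card_eq_three.2 ⟨v, u, w, hu.ne, hw.ne, huw, rfl⟩]
        at this
      have := hthree (root v)
      omega
    have hall : ∀ f ∈ ({s(v, u), s(v, w)} : Set (Sym2 V)), ∀ x ∈ f, root x = root v := by
      simp [h1, h2]
    rcases hr with h | h | h
    · exact ⟨⟨_, hin u w huw h1 h2 (h.trans_ne hu.ne) (h.trans_ne hw.ne)⟩,
        .inr ⟨root v, by simp [h1, h2], hall⟩⟩
    · exact ⟨⟨_, hin v w hw.ne rfl h2 (h.trans_ne hu.ne') (h.trans_ne huw)⟩, .inr ⟨root v, by simp [h2], hall⟩⟩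
    · exact ⟨⟨_, hin v u hu.ne rfl h1 (h.trans_ne hw.ne') (h.trans_ne huw.symm)⟩,
        .inr ⟨root v, by simp [h1], hall⟩⟩
  choose col hcol using hex
  refine (Coloring.mk col ?_).colorable
  rintro ⟨P, hP⟩ ⟨Q, hQ⟩ ⟨-, hPQ⟩ heq
  have cP := hcol ⟨P, hP⟩
  have cQ := hcol ⟨Q, hQ⟩
  rw [← heq] at cQ
  dsimp only at cP cQ hPQ
  rcases cP with ⟨h1, h2⟩ | ⟨r, h1, h2⟩ <;> rcases cQ with ⟨h3, h4⟩ | ⟨r', h3, h4⟩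
  · exact Set.disjoint_left.1 hPQ h1 h3
  · exact h2 ⟨r', h3⟩
  · exact h4 ⟨r, h1⟩
  -- Both paths lie in the part of their common colour; being disjoint, they would give four edges
  -- on at most three vertices.
  · obtain rfl : r = r' := by
      rw [← h1 _ (Sym2.out_fst_mem _), h3 _ (Sym2.out_fst_mem _)]
    obtain ⟨v, u, w, huw, hu, hw, rfl⟩ := mem_edgeSet_copyHypergraph_path_two.1 hP
    obtain ⟨v', u', w', huw', hu', hw', rfl⟩ := mem_edgeSet_copyHypergraph_path_two.1 hQ
    have hpair : ∀ {v u w : V}, u ≠ w → #({s(v, u), s(v, w)} : Finset (Sym2 V)) = 2 :=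
      fun h => card_pair fun h' => h (Sym2.congr_right.1 h')
    have hdisj : Disjoint ({s(v, u), s(v, w)} : Finset (Sym2 V)) {s(v', u'), s(v', w')} := by
      rw [← disjoint_coe]; simpa using hPQ
    have hsub : ({s(v, u), s(v, w)} : Finset (Sym2 V)) ∪ {s(v', u'), s(v', w')} ⊆
        ({x | root x = r} : Finset V).offDiag.image Sym2.mk.uncurry := by
      have hmem : ∀ {x y : V}, G.Adj x y → root x = r → root y = r → s(x, y) ∈
          ({x | root x = r} : Finset V).offDiag.image Sym2.mk.uncurry :=
        fun {x y} h hx hy => mem_image.2 ⟨(x, y), by simp [hx, hy, h.ne], rfl⟩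
      intro e he
      simp only [mem_union, mem_insert, mem_singleton] at he
      simp only [Set.mem_insert_iff, Set.mem_singleton_iff] at h2 h4
      rcases he with (rfl | rfl) | rfl | rfl
      · exact hmem hu (h2 _ (.inl rfl) v (by simp)) (h2 _ (.inl rfl) u (by simp))
      · exact hmem hw (h2 _ (.inr rfl) v (by simp)) (h2 _ (.inr rfl) w (by simp))
      · exact hmem hu' (h4 _ (.inl rfl) v' (by simp)) (h4 _ (.inl rfl) u' (by simp))
      · exact hmem hw' (h4 _ (.inr rfl) v' (by simp)) (h4 _ (.inr rfl) w' (by simp))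
    have hc := card_le_card hsub
    rw [card_union_of_disjoint hdisj, hpair huw, hpair huw', Sym2.card_image_offDiag] at hc
    have := Nat.choose_le_choose 2 (hthree r)
    norm_num [Nat.choose] at this
    omega

end SimpleGraph

/-! ### Lower bound: intersecting families and counting two-edge paths. -/

/-- A family of pairwise intersecting pairs without a common element has at most three members. -/
theorem Set.exists_card_le_three_of_intersecting_pairs {α : Type*} {𝓕 : Set (Set α)}
    (h2 : ∀ P ∈ 𝓕, ∃ a b, a ≠ b ∧ P = {a, b})
    (hint : ∀ P ∈ 𝓕, ∀ Q ∈ 𝓕, ¬ Disjoint P Q) (hno : ¬ ∃ e, ∀ P ∈ 𝓕, e ∈ P) :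
    ∃ 𝓣 : Finset (Set α), #𝓣 ≤ 3 ∧ 𝓕 ⊆ 𝓣 := by
  classical
  rcases 𝓕.eq_empty_or_nonempty with rfl | ⟨P, hP⟩
  · exact ⟨∅, by simp, by simp⟩
  obtain ⟨a, b, hab, rfl⟩ := h2 P hP
  -- A member missing `a` must meet `{a, b}` in `b`. Applied at both ends, this gives two sides of a
  -- triangle on `a, b`.
  have key : ∀ {a b : α}, {a, b} ∈ 𝓕 → ∃ c, c ≠ a ∧ {b, c} ∈ 𝓕 := by
    intro a b hP
    push Not at hno
    obtain ⟨Q, hQ, haQ⟩ := hno a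
    obtain ⟨c, d, hcd, rfl⟩ := h2 Q hQ
    have hbQ : b ∈ ({c, d} : Set α) := by
      by_contra hb
      refine hint _ hP _ hQ (Set.disjoint_left.2 ?_)
      rintro x (rfl | rfl)
      exacts [haQ, hb]
    rcases hbQ with rfl | rfl
    · exact ⟨d, by rintro rfl; simp at haQ, hQ⟩
    · exact ⟨c, by rintro rfl; simp at haQ, by rwa [Set.pair_comm]⟩
  obtain ⟨c, hca, hQ⟩ := key hP
  obtain ⟨d, hdb, hR⟩ := key (a := b) (b := a) (by rwa [Set.pair_comm] at hP)
  have hcd : d = c := by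
    by_contra hcd
    refine hint _ hQ _ hR ?_
    simp only [Set.disjoint_insert_left, Set.disjoint_singleton_left, Set.mem_insert_iff,
      Set.mem_singleton_iff]
    exact ⟨not_or.2 ⟨hab.symm, hdb.symm⟩, not_or.2 ⟨hca, Ne.symm hcd⟩⟩
  subst hcd
  refine ⟨{{a, b}, {b, d}, {a, d}}, card_le_three, fun S hS => ?_⟩
  obtain ⟨p, q, hpq, rfl⟩ := h2 S hS
  have i1 := hint _ hS _ hP
  have i2 := hint _ hS _ hQ
  have i3 := hint _ hS _ hR
  simp only [Set.disjoint_insert_left, Set.disjoint_singleton_left, Set.mem_insert_iff,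
    Set.mem_singleton_iff] at i1 i2 i3
  simp only [coe_insert, coe_singleton, Set.mem_insert_iff, Set.mem_singleton_iff,
    Set.pair_eq_pair_iff]
  grind

/-- This is (d - 2)² ≥ 0. -/
theorem Nat.three_mul_le_four_add_two_mul_choose_two (d : ℕ) : 3 * d ≤ 4 + 2 * d.choose 2 := by
  induction d with
  | zero => simp
  | succ d ih =>
    have : (d + 1).choose 2 = d + d.choose 2 := by
      rw [Nat.choose_succ_succ' d 1, Nat.choose_one_right]
    rw [this]
    rcases d with _ | _ | d
    · simp
    · simp
    · omega

namespace SimpleGraph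

variable {V : Type*} {G : SimpleGraph V}

/-- A graph with few pairs of adjacent edges has few edges. -/
theorem three_mul_card_edgeFinset_le [Fintype V] [DecidableRel G.Adj] :
    3 * #G.edgeFinset ≤ 2 * Fintype.card V + ∑ v, (G.degree v).choose 2 := by
  have h := sum_le_sum fun v (_ : v ∈ univ) =>
    Nat.three_mul_le_four_add_two_mul_choose_two (G.degree v)
  rw [← mul_sum, sum_add_distrib, ← mul_sum, sum_degrees_eq_twice_card_edges] at h
  simp only [sum_const, card_univ, smul_eq_mul] at h
  omega

theorem sum_degree_choose_two_le [Fintype V] [DecidableRel G.Adj]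
    [DecidableEq V] (𝒬 : Finset (Set (Sym2 V)))
    (h𝒬 : ∀ v u w, u ≠ w → G.Adj v u → G.Adj v w → {s(v, u), s(v, w)} ∈ 𝒬) :
    ∑ v, (G.degree v).choose 2 ≤ #𝒬 := by
  have : ∑ v, (G.degree v).choose 2 = #(univ.sigma fun v => powersetCard 2 (G.neighborFinset v)) := by
    rw [card_sigma]
    simp
  rw [this]
  refine card_le_card_of_injOn (fun x => (fun w => s(x.1, w)) '' (x.2 : Set V)) ?_ ?_
  · rintro ⟨v, p⟩ hx
    simp only [coe_sigma, Set.mem_sigma_iff, mem_coe, mem_univ, true_and, mem_powersetCard] at hx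
    obtain ⟨u, w, huw, rfl⟩ := card_eq_two.1 hx.2
    rw [insert_subset_iff, singleton_subset_iff, mem_neighborFinset, mem_neighborFinset] at hx
    simpa [Set.image_pair] using h𝒬 v u w huw hx.1.1 hx.1.2
  · rintro ⟨v, p⟩ hx ⟨v', p'⟩ hx' h
    simp only [coe_sigma, Set.mem_sigma_iff, mem_coe, mem_univ, true_and, mem_powersetCard] at hx
    dsimp only at h
    -- The centre is recovered as the common endpoint of the two edges.
    obtain rfl : v = v' := by
      obtain ⟨a, b, hab, rfl⟩ := card_eq_two.1 hx.2
      have ha : s(v, a) ∈ (fun w => s(v', w)) '' (p' : Set V) := h ▸ ⟨a, by simp, rfl⟩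
      have hb : s(v, b) ∈ (fun w => s(v', w)) '' (p' : Set V) := h ▸ ⟨b, by simp, rfl⟩
      obtain ⟨c, -, hc : s(v', c) = s(v, a)⟩ := ha
      obtain ⟨d, -, hd : s(v', d) = s(v, b)⟩ := hb
      have h1 : v' = v ∨ v' = a := by
        have := Sym2.mem_mk_left v' c
        rwa [hc, Sym2.mem_iff] at this
      have h2 : v' = v ∨ v' = b := by
        have := Sym2.mem_mk_left v' d
        rwa [hd, Sym2.mem_iff] at this
      grind
    have := Set.image_injective.2 (fun a b hab => Sym2.congr_right.1 hab) h
    rw [coe_inj] at this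
    rw [this]

theorem card_edgeFinset_le_of_coloring [Fintype V] [Fintype G.edgeSet] {c : ℕ}
    (C : (G.copyKneserGraph (pathOfLength 2)).Coloring (Fin c)) :
    #G.edgeFinset ≤ c + 2 * Fintype.card V / 3 := by
  classical
  -- Unused colours belong to `A` vacuously.
  let A : Finset (Fin c) := {i | ∃ e, ∀ P, C P = i → e ∈ P.1}
  have hA : ∀ i ∈ A, ∃ e, ∀ P, C P = i → e ∈ P.1 := by simp [A]
  rcases isEmpty_or_nonempty V with hV | ⟨⟨v⟩⟩
  · have : G.edgeFinset = ∅ := eq_empty_of_isEmpty _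
    simp [this]
  have : Nonempty (Sym2 V) := ⟨s(v, v)⟩
  choose! center hcenter using hA
  let H := G.deleteEdges (A.image center : Set (Sym2 V))
  have hHG : H ≤ G := deleteEdges_le _
  have hEH : #G.edgeFinset ≤ #H.edgeFinset + #A := by
    have : G.edgeFinset ⊆ H.edgeFinset ∪ A.image center := by
      intro e he
      rw [mem_edgeFinset] at he
      rw [mem_union, mem_edgeFinset, edgeSet_deleteEdges]
      by_cases h : e ∈ A.image center
      · exact .inr h
      · exact .inl ⟨he, h⟩
    have h1 := card_le_card this
    have h2 := card_union_le H.edgeFinset (A.image center)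
    have h3 := card_image_le (s := A) (f := center)
    omega
  have := Fintype.ofFinite (G.copyHypergraph (pathOfLength 2)).edgeSet
  let 𝒬 : Finset (G.copyHypergraph (pathOfLength 2)).edgeSet := {P | P.1 ⊆ H.edgeSet}
  have h𝒬 : #𝒬 ≤ 3 * #Aᶜ := by
    refine card_le_mul_card_image_of_maps_to (f := C) (fun P hP => ?_) 3 fun i hi => ?_
    · rw [mem_compl]
      intro hPA
      have h1 := hcenter _ hPA P rfl
      have h2 := (mem_filter.1 hP).2 h1
      rw [edgeSet_deleteEdges] at h2
      exact h2.2 (mem_image_of_mem _ hPA)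
    · have hi' : ¬ ∃ e, ∀ P, C P = i → e ∈ P.1 := by simpa [A] using hi
      obtain ⟨𝓣, h𝓣, hsub⟩ := Set.exists_card_le_three_of_intersecting_pairs
        (𝓕 := Subtype.val '' {P | C P = i}) (by
          rintro _ ⟨⟨P, hP⟩, -, rfl⟩
          obtain ⟨v, u, w, huw, -, -, rfl⟩ := mem_edgeSet_copyHypergraph_path_two.1 hP
          exact ⟨_, _, fun h => huw (Sym2.congr_right.1 h), rfl⟩) (by
          rintro _ ⟨P, hP, rfl⟩ _ ⟨Q, hQ, rfl⟩ hd
          by_cases hPQ : P = Q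
          · subst hPQ
            obtain ⟨v, u, w, -, -, -, h⟩ := mem_edgeSet_copyHypergraph_path_two.1 P.2
            rw [h, disjoint_self] at hd
            exact (Set.insert_nonempty _ _).ne_empty hd
          · exact C.valid (show (G.copyKneserGraph _).Adj P Q from ⟨hPQ, hd⟩)
              (Eq.trans hP (Eq.symm hQ))) (by
          rintro ⟨e, he⟩
          exact hi' ⟨e, fun P hP => he _ ⟨P, hP, rfl⟩⟩)
      refine (card_le_card_of_injOn Subtype.val (fun P hP => ?_)
        Subtype.val_injective.injOn).trans h𝓣
      exact hsub ⟨P, (mem_filter.1 hP).2, rfl⟩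
  have hsum : ∑ v, (H.degree v).choose 2 ≤ #(𝒬.image Subtype.val) := by
    refine sum_degree_choose_two_le _ fun v u w huw hu hw => ?_
    refine mem_image.2 ⟨⟨_, mem_edgeSet_copyHypergraph_path_two.2
      ⟨v, u, w, huw, hHG hu, hHG hw, rfl⟩⟩, mem_filter.2 ⟨mem_univ _, ?_⟩, rfl⟩
    rintro e (rfl | rfl)
    exacts [hu, hw]
  have h1 := card_image_le (s := 𝒬) (f := Subtype.val)
  have h2 := three_mul_card_edgeFinset_le (G := H)
  have h3 := card_compl_add_card A
  rw [Fintype.card_fin] at h3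
  omega

end SimpleGraph

end

theorem mainTheorem4 {V : Type*} [Fintype V] (G : SimpleGraph V) [DecidableRel G.Adj]
    (n : ℕ) (hn : Fintype.card V = n)
    (hdeg : ∀ x y : V, x ≠ y → ¬ G.Adj x y →
      (G.degree x : ℝ) + (G.degree y : ℝ) ≥ 4 * (n : ℝ) / 3 - 1) :
    ⌊(2 / 3 : ℝ) * (n : ℝ)⌋₊ ≤ G.edgeFinset.card ∧
    (G.copyKneserGraph (SimpleGraph.pathOfLength 2)).chromaticNumber =
      ((G.edgeFinset.card - ⌊(2 / 3 : ℝ) * (n : ℝ)⌋₊ : ℕ) : ℕ∞) := by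
  classical
  have hfloor : ⌊(2 / 3 : ℝ) * (n : ℝ)⌋₊ = 2 * n / 3 := by
    rw [← Nat.floor_div_eq_div (K := ℝ)]
    congr 1
    push_cast
    ring
  rw [hfloor]
  obtain ⟨root, hadj, hthree, hroot, himage⟩ := G.exists_root_of_ore fun x y hxy nxy => by
    have h := hdeg x y hxy nxy
    rw [hn, ← Nat.cast_le (α := ℝ)]
    push_cast
    linarith
  obtain ⟨hle, hcol⟩ := SimpleGraph.colorable_copyKneserGraph_path_two hadj hthree hroot
  rw [hn] at himage hle hcol
  -- With at most ⌈n/3⌉ parts, the stars have at least n - ⌈n/3⌉ = ⌊2n/3⌋ edges.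
  refine ⟨by omega, le_antisymm (hcol.mono (by omega)).chromaticNumber_le ?_⟩
  rw [SimpleGraph.le_chromaticNumber_iff_coloring]
  intro m C
  have := SimpleGraph.card_edgeFinset_le_of_coloring C
  rw [hn] at this
  omega
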